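/- Let $\|\cdot\|$ be a norm on $\mathbb{R}^d$ and let $f \colon \mathbb{R}^d \to \mathbb{R}$ be piecewise affine, that is, there are finitely many polyhedral sets $Q_1, \ldots, Q_s$ (finite intersections of closed half-spaces) with nonempty, pairwise disjoint interiors and with union $\mathbb{R}^d$, such that $f$ coincides with an affine function on each $Q_i$. Put $S(f) = \{ x \in \mathbb{R}^d \mid f(x) \le 0 \}$ and let $0^+ S(f)$ be the set of all $z \in \mathbb{R}^d$ for which there is $x \in S(f)$ with $x + \lambda z \in S(f)$ for all $\lambda \ge 0$. For $V \subseteq \mathbb{R}^d$, we say that $f$ has an error bound on $V$ if there is $\tau > 0$ with $\tau \operatorname{dist}(x, S(f)) \le \max\{ f(x), 0 \}$ for all $x \in V$, and that $f$ is coercive on $V$ if $f(x_n) \to +\infty$ for every sequence $\{ x_n \} \subset V$ with $\| x_n \| \to +\infty$ (which holds vacuously if $V$ is bounded). For $V = \mathbb{R}^d$ we say that $f$ has a global error bound and that $f$ is coercive, respectively. A cone is a set $V \subseteq \mathbb{R}^d$ such that $t x \in V$ for all $x \in V$ and $t > 0$ (not necessarily convex or closed). Then: 1. Let $S(f)$ be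 nonempty and let $V$ be a cone. If $f$ is coercive on $V$, then $f$ has an error bound on $V$. Conversely, if $0^+ S(f) \cap \operatorname{cl} V = \{ 0 \}$ and $f$ has an error bound on $V$, then $f$ is coercive on $V$. 2. If $S(f)$ is nonempty and $f$ is coercive, then $f$ has a global error bound. 3. The function $f$ is coercive if and only if $$\liminf_{\| x \| \to +\infty} \frac{f(x)}{\| x \|} > 0,$$ where the lower limit is taken in $[-\infty, +\infty]$. (Here $S(f)$ may be empty.) -/

import Mathlib

open Filter Topology

namespace PAErrorBound

section

variable {E : Type*} [NormedAddCommGroup E] [NormedSpace ℝ E]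

/-- A closed half-space `{x | ℓ x ≤ b}` with `ℓ` a nonzero linear functional. -/
def IsClosedHalfSpace (H : Set E) : Prop :=
  ∃ (l : E →ₗ[ℝ] ℝ) (b : ℝ), l ≠ 0 ∧ H = {x | l x ≤ b}

/-- A polyhedral set: the intersection of a finite number of closed half-spaces
(the whole space being the intersection of none). -/
def IsPolyhedral (Q : Set E) : Prop :=
  ∃ (m : ℕ) (H : Fin m → Set E), (∀ k, IsClosedHalfSpace (H k)) ∧ Q = ⋂ k, H k

/-- A polyhedral partition of the space: a finite family of polyhedral sets with nonempty,
pairwise disjoint interiors that covers the space. -/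
structure IsPolyhedralPartition {s : ℕ} (Q : Fin s → Set E) : Prop where
  polyhedral : ∀ i, IsPolyhedral (Q i)
  cover : ⋃ i, Q i = Set.univ
  interior_nonempty : ∀ i, (interior (Q i)).Nonempty
  interior_disjoint : ∀ i j, i ≠ j → interior (Q i) ∩ interior (Q j) = ∅

/-- A real-valued piecewise affine function: it coincides with an affine function on each
member of some polyhedral partition of the space. -/
def IsPiecewiseAffine (f : E → ℝ) : Prop :=
  ∃ (s : ℕ) (Q : Fin s → Set E) (F : Fin s → (E →ᵃ[ℝ] ℝ)),
    IsPolyhedralPartition Q ∧ ∀ i, ∀ x ∈ Q i, f x = F i x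

/-- The lower `0`-level set `S(f) = {x | f x ≤ 0}`. -/
def levelSet (f : E → ℝ) : Set E := {x | f x ≤ 0}

/-- The recession cone `0⁺ Q`: all directions of rays contained in `Q`. -/
def recessionCone (Q : Set E) : Set E :=
  {z | ∃ x ∈ Q, ∀ t : ℝ, 0 ≤ t → x + t • z ∈ Q}

/-- A (not necessarily convex or closed) cone: a set closed under multiplication by positive
scalars. It need not contain the origin. -/
def IsCone (V : Set E) : Prop := ∀ x ∈ V, ∀ t : ℝ, 0 < t → t • x ∈ V

/-- `f` has an error bound on `V`: for some `τ > 0`, `τ dist(x, S(f)) ≤ max (f x) 0` on `V`.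
The distance is used only where `S(f)` is nonempty. -/
def HasErrorBoundOn (f : E → ℝ) (V : Set E) : Prop :=
  ∃ τ : ℝ, 0 < τ ∧ ∀ x ∈ V, τ * Metric.infDist x (levelSet f) ≤ max (f x) 0

/-- `f` has a global error bound. -/
def HasGlobalErrorBound (f : E → ℝ) : Prop := HasErrorBoundOn f Set.univ

/-- `f` is coercive on `V`: `f (x n) → +∞` along every sequence in `V` with `‖x n‖ → +∞`. -/
def IsCoerciveOn (f : E → ℝ) (V : Set E) : Prop :=
  ∀ x : ℕ → E, (∀ n, x n ∈ V) → Tendsto (fun n => ‖x n‖) atTop atTop →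
    Tendsto (fun n => f (x n)) atTop atTop

/-- `f` is coercive (on the whole space). -/
def IsCoerciveFun (f : E → ℝ) : Prop := IsCoerciveOn f Set.univ

/-- `liminf f x / ‖x‖` as `‖x‖ → +∞`, as an extended real number. -/
noncomputable def growthAtInfinity (f : E → ℝ) : EReal :=
  liminf (fun x : E => ((f x / ‖x‖ : ℝ) : EReal)) (comap (fun x : E => ‖x‖) atTop)

end

end PAErrorBound

open PAErrorBound

open Filter Topology

namespace PAErrorBound

/-! ### Affine inequalities and coercivity on cones -/

section

variable {E : Type*} [NormedAddCommGroup E] [NormedSpace ℝ E]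

/-! Everything reduces to linear growth. Along each ray from the origin `f` stays within a uniform
constant `C` of a linear function of the parameter (`exists_slope_bound`), so coercivity on a cone
`V` forces `c * ‖x‖ - C ≤ f x` there (`IsCoerciveOn.exists_linear_growth`). With `V` the whole space
this gives the positive lower limit.

Linear growth yields error bounds piece by piece. If a piece meets S(f), Hoffman's bound applies to
its inequalities together with that of the affine branch; if not, `f` is bounded below by a positive
constant on the part of the piece in `V`, and the distance to S(f) grows at most linearly in `‖x‖`.

Conversely, under an error bound a failure of coercivity produces a unit recession direction of S(f)
in the closure of `V`. -/

/-- The solution set of a family of affine inequalities `g k x ≤ 0`. -/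
def affineSublevel {ι : Type*} (g : ι → E →ᵃ[ℝ] ℝ) : Set E := {x | ∀ k, g k x ≤ 0}

theorem affineMap_add (g : E →ᵃ[ℝ] ℝ) (x v : E) : g (x + v) = g.linear v + g x := by
  have := g.map_vadd x v
  simpa [add_comm] using this

theorem IsPolyhedral.exists_affineSublevel {Q : Set E} (hQ : IsPolyhedral Q) :
    ∃ (m : ℕ) (g : Fin m → E →ᵃ[ℝ] ℝ), Q = affineSublevel g := by
  obtain ⟨m, H, hH, rfl⟩ := hQ
  choose l b _ hl using hH
  refine ⟨m, fun k => (l k).toAffineMap - AffineMap.const ℝ E (b k), ?_⟩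
  ext x
  simp [affineSublevel, hl]

theorem exists_frequently_mem {X ι : Type*} [Finite ι] {Q : ι → Set X} (hQ : ∀ x, ∃ i, x ∈ Q i)
    (u : ℕ → X) : ∃ i, ∃ᶠ n in atTop, u n ∈ Q i := by
  by_contra! h
  obtain ⟨n, hn⟩ := (eventually_all.2 h).exists
  obtain ⟨i, hi⟩ := hQ (u n)
  exact hn i hi

/-- A point violating the bound with `c = 1 / (n + 1)` has ray slope at most `‖x n‖ / (n + 1)`.
Stretched to norm `n + 1`, these points still have values at most `1 + C`, against coercivity. -/
theorem IsCoerciveOn.exists_linear_growth {f : E → ℝ} {V : Set E} {C : ℝ}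
    (hC : ∀ z, ∃ m : ℝ, ∀ t : ℝ, 0 ≤ t → |f (t • z) - t * m| ≤ C)
    (hV : IsCone V) (hf : IsCoerciveOn f V) : ∃ c : ℝ, 0 < c ∧ ∀ x ∈ V, c * ‖x‖ - C ≤ f x := by
  by_contra! hcon
  have hpos : ∀ n : ℕ, (0 : ℝ) < 1 / ((n : ℝ) + 1) := fun n => Nat.one_div_pos_of_nat
  choose x hxV hx using fun n : ℕ => hcon _ (hpos n)
  choose m hm using hC
  have hx0 : ∀ n, 0 < ‖x n‖ := fun n => by
    refine norm_pos_iff.2 fun h => ?_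
    have h1 := hx n
    have h2 := (abs_le.1 (hm 0 0 le_rfl)).1
    simp only [h, norm_zero, mul_zero, zero_sub, smul_zero, zero_mul, sub_zero] at h1 h2
    linarith
  have ht : ∀ n : ℕ, 0 < ((n : ℝ) + 1) / ‖x n‖ := fun n => div_pos (by positivity) (hx0 n)
  have hlim := hf (fun n => (((n : ℝ) + 1) / ‖x n‖) • x n) (fun n => hV _ (hxV n) _ (ht n)) (by
    have : (fun n : ℕ => ‖(((n : ℝ) + 1) / ‖x n‖) • x n‖) = fun n : ℕ => (n : ℝ) + 1 := by
      ext n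
      rw [norm_smul, Real.norm_of_nonneg (ht n).le, div_mul_cancel₀ _ (hx0 n).ne']
    rw [this]
    exact tendsto_atTop_add_const_right _ _ tendsto_natCast_atTop_atTop)
  obtain ⟨n, hn⟩ := (hlim.eventually_gt_atTop (1 + C)).exists
  have h1 := (abs_le.1 (hm (x n) _ (ht n).le)).2
  have h2 := (abs_le.1 (hm (x n) 1 zero_le_one)).1
  rw [one_smul, one_mul] at h2
  have h3 : m (x n) ≤ 1 / ((n : ℝ) + 1) * ‖x n‖ := by linarith [hx n]
  have h4 : ((n : ℝ) + 1) / ‖x n‖ * m (x n) ≤ 1 := by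
    refine (mul_le_mul_of_nonneg_left h3 (ht n).le).trans (le_of_eq ?_)
    have := (hx0 n).ne'
    field_simp
  linarith

/-! ### Polyhedral sets: asymptotic directions and Hoffman's bound -/

variable [FiniteDimensional ℝ E]

theorem isClosed_affineSublevel {ι : Type*} (g : ι → E →ᵃ[ℝ] ℝ) :
    IsClosed (affineSublevel g) := by
  simp only [affineSublevel, Set.ofPred_forall]
  exact isClosed_iInter fun k =>
    isClosed_le (AffineMap.continuous_of_finiteDimensional (g k)) continuous_const

/-- Asymptotic directions of a set defined by affine inequalities satisfy the associated
homogeneous linear inequalities. -/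
theorem linear_nonpos_of_tendsto {ι : Type*} (g : ι → E →ᵃ[ℝ] ℝ) {s : ℕ → E} {r : ℕ → ℝ} {u : E}
    (hr : Tendsto r atTop atTop) (hs : ∃ᶠ n in atTop, s n ∈ affineSublevel g)
    (hu : Tendsto (fun n => (r n)⁻¹ • s n) atTop (𝓝 u)) (k : ι) : (g k).linear u ≤ 0 := by
  have hc := ((LinearMap.continuous_of_finiteDimensional (g k).linear).tendsto u).comp hu
  have h0 : Tendsto (fun n => (r n)⁻¹ * g k 0) atTop (𝓝 0) := by
    simpa using (tendsto_inv_atTop_zero.comp hr).mul_const (g k 0)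
  have hsum := hc.add h0
  rw [add_zero] at hsum
  refine le_of_tendsto_of_frequently hsum ?_
  refine (hs.and_eventually (hr.eventually_gt_atTop 0)).mono ?_
  rintro n ⟨hn, hrn⟩
  have h1 := hn k
  have h2 := affineMap_add (g k) 0 (s n)
  rw [zero_add] at h2
  simp only [Function.comp_apply, map_smul, smul_eq_mul]
  rw [← mul_add, ← h2]
  exact mul_nonpos_of_nonneg_of_nonpos (inv_pos.2 hrn).le h1

/-- Hoffman's error bound for finite systems of affine inequalities. -/
theorem hoffman_bound {ι : Type*} [Finite ι] (g : ι → E →ᵃ[ℝ] ℝ)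
    (hne : (affineSublevel g).Nonempty) :
    ∃ τ : ℝ, 0 < τ ∧ ∀ x, x ∉ affineSublevel g →
      ∃ k, τ * Metric.infDist x (affineSublevel g) ≤ g k x := by
  by_contra! hcon
  have hcl := isClosed_affineSublevel g
  have hpos : ∀ n : ℕ, (0 : ℝ) < 1 / ((n : ℝ) + 1) := fun n => Nat.one_div_pos_of_nat
  choose x hx hxg using fun n : ℕ => hcon _ (hpos n)
  choose p hp hpd using fun n => hcl.exists_infDist_eq_dist hne (x n)
  set r : ℕ → ℝ := fun n => dist (x n) (p n) with hr
  have hrpos : ∀ n, 0 < r n := fun n => dist_pos.2 fun h => hx n (h ▸ hp n)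
  set d : ℕ → E := fun n => (r n)⁻¹ • (x n - p n) with hd
  have hxd : ∀ n, x n = p n + r n • d n := fun n => by
    simp [hd, smul_smul, mul_inv_cancel₀ (hrpos n).ne']
  have hdn : ∀ n, d n ∈ Metric.sphere (0 : E) 1 := fun n => by
    rw [mem_sphere_zero_iff_norm, hd]
    simp only [norm_smul, norm_inv, Real.norm_of_nonneg (hrpos n).le]
    rw [← dist_eq_norm]
    exact inv_mul_cancel₀ (hrpos n).ne'
  clear_value d
  obtain ⟨u, -, φ, hφ, hu⟩ := (isCompact_sphere (0 : E) 1).tendsto_subseq hdn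
  -- Far along the subsequence, no constraint active at the projection increases in the limit
  -- direction `u`.
  have hactive : ∀ k, ∀ᶠ n in atTop, g k (p (φ n)) = 0 → (g k).linear u ≤ 0 := by
    intro k
    by_cases hk : (g k).linear u ≤ 0
    · exact Eventually.of_forall fun _ _ => hk
    push Not at hk
    have hlim := ((LinearMap.continuous_of_finiteDimensional (g k).linear).tendsto u).comp hu
    have hlim0 := (tendsto_one_div_add_atTop_nhds_zero_nat (𝕜 := ℝ)).comp hφ.tendsto_atTop
    filter_upwards [hlim0.eventually_lt hlim hk] with n hn h0
    exfalso
    have h1 := hxg (φ n) k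
    rw [hpd, hxd (φ n), affineMap_add, h0, add_zero, map_smul, smul_eq_mul, ← hxd] at h1
    have h2 : (g k).linear (d (φ n)) < 1 / ((φ n : ℝ) + 1) := by
      have h3 : r (φ n) * (g k).linear (d (φ n)) < r (φ n) * (1 / ((φ n : ℝ) + 1)) := by
        rw [mul_comm (r (φ n)) (1 / _)]
        exact h1
      exact lt_of_mul_lt_mul_left h3 (hrpos _).le
    exact lt_asymm h2 hn
  have hnear : ∀ᶠ n in atTop, dist (d (φ n)) u < 1 :=
    hu.eventually (Metric.ball_mem_nhds u one_pos)
  obtain ⟨n, hn, hdu⟩ := ((eventually_all.2 hactive).and hnear).exists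
  -- Hence a short step from the projection along `u` stays feasible. As `d (φ n)` is within
  -- distance 1 of `u`, it ends strictly closer to `x (φ n)`, which is absurd.
  have hstep : ∀ k, ∀ᶠ ε in 𝓝[>] (0 : ℝ), g k (p (φ n) + ε • u) ≤ 0 := by
    intro k
    rcases (hp (φ n) k).lt_or_eq with hlt | heq
    · have hcont : Continuous fun ε : ℝ => g k (p (φ n) + ε • u) :=
        (AffineMap.continuous_of_finiteDimensional (g k)).comp (by fun_prop)
      have hlim := hcont.tendsto 0
      simp only [zero_smul, add_zero] at hlim
      exact ((hlim.eventually_lt_const hlt).filter_mono nhdsWithin_le_nhds).mono fun _ h => h.le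
    · filter_upwards [self_mem_nhdsWithin] with ε hε
      rw [affineMap_add, heq, add_zero, map_smul, smul_eq_mul]
      exact mul_nonpos_of_nonneg_of_nonpos (le_of_lt hε) (hn k heq)
  have hsmall : ∀ᶠ ε in 𝓝[>] (0 : ℝ), ε ∈ Set.Ioo 0 (r (φ n)) :=
    Ioo_mem_nhdsGT (hrpos _)
  obtain ⟨ε, hεP, hε0, hεr⟩ := ((eventually_all.2 hstep).and hsmall).exists
  have hle : r (φ n) ≤ dist (x (φ n)) (p (φ n) + ε • u) := by
    rw [hr]
    simp only
    rw [← hpd]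
    exact Metric.infDist_le_dist_of_mem hεP
  have heq : x (φ n) - (p (φ n) + ε • u) = (r (φ n) - ε) • d (φ n) + ε • (d (φ n) - u) := by
    rw [hxd (φ n)]
    module
  rw [dist_eq_norm, heq] at hle
  have h1 := norm_add_le ((r (φ n) - ε) • d (φ n)) (ε • (d (φ n) - u))
  rw [norm_smul, norm_smul, mem_sphere_zero_iff_norm.1 (hdn _), mul_one,
    Real.norm_of_nonneg (sub_pos.2 hεr).le, Real.norm_of_nonneg hε0.le, ← dist_eq_norm] at h1
  have h2 : ε * dist (d (φ n)) u < ε * 1 := mul_lt_mul_of_pos_left hdu hε0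
  linarith

/-! ### Lipschitz continuity and slopes along rays -/

/-- A function that agrees with affine functions on the members of a finite closed cover is
Lipschitz continuous. -/
theorem exists_abs_sub_le_of_closed_cover {ι : Type*} [Finite ι] {f : E → ℝ} {Q : ι → Set E}
    {F : ι → E →ᵃ[ℝ] ℝ} (hcl : ∀ i, IsClosed (Q i)) (hcov : ∀ x, ∃ i, x ∈ Q i)
    (hF : ∀ i, ∀ x ∈ Q i, f x = F i x) :
    Continuous f ∧ ∃ L : ℝ, 0 ≤ L ∧ ∀ x v, |f (x + v) - f x| ≤ L * ‖v‖ := by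
  have hcont : Continuous f :=
    (locallyFinite_of_finite Q).continuous (Set.eq_univ_of_forall fun x => Set.mem_iUnion.2 (hcov x))
      hcl fun i => (AffineMap.continuous_of_finiteDimensional (F i)).continuousOn.congr (hF i)
  refine ⟨hcont, ?_⟩
  let l : ι → E →L[ℝ] ℝ := fun i => LinearMap.toContinuousLinearMap (F i).linear
  obtain ⟨M, hM⟩ := (Set.finite_range fun i => ‖l i‖).bddAbove
  have hl : ∀ i v, |(F i).linear v| ≤ max M 0 * ‖v‖ := fun i v => by
    have h1 := (l i).le_opNorm v
    have h2 : ‖l i‖ ≤ max M 0 := (hM ⟨i, rfl⟩).trans (le_max_left _ _)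
    exact h1.trans (mul_le_mul_of_nonneg_right h2 (norm_nonneg v))
  refine ⟨max M 0, le_max_right _ _, fun x v => ?_⟩
  set L := max M 0
  let A : Set ℝ := {t | |f (x + t • v) - f x| ≤ t * (L * ‖v‖)}
  have hA : IsClosed A := isClosed_le (by fun_prop) (by fun_prop)
  -- Continuous induction: one piece contains points with parameters decreasing to `t`, hence, being
  -- closed, the point at `t` itself, so `f` is affine between them.
  have hsub : Set.Icc (0 : ℝ) 1 ⊆ A := by
    refine IsClosed.Icc_subset_of_forall_exists_gt (hA.inter isClosed_Icc) (by simp [A]) ?_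
    rintro t ⟨ht, -⟩ y hy
    obtain ⟨w, -, hw, hwt⟩ := exists_seq_strictAnti_tendsto' (show t < y from hy)
    obtain ⟨i, hi⟩ := exists_frequently_mem hcov fun n => x + w n • v
    have hti : x + t • v ∈ Q i := (hcl i).mem_of_frequently_of_tendsto hi
      (tendsto_const_nhds.add (hwt.smul_const v))
    obtain ⟨n, hn⟩ := hi.exists
    refine ⟨w n, ?_, (hw n).1, (hw n).2.le⟩
    have heq : x + w n • v = (x + t • v) + (w n - t) • v := by module
    have h1 : f (x + w n • v) - f (x + t • v) = (w n - t) * (F i).linear v := by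
      rw [hF i _ hn, hF i _ hti, heq, affineMap_add, map_smul, smul_eq_mul]
      ring
    have h2 : |f (x + w n • v) - f (x + t • v)| ≤ (w n - t) * (L * ‖v‖) := by
      rw [h1, abs_mul, abs_of_pos (sub_pos.2 (hw n).1)]
      exact mul_le_mul_of_nonneg_left (hl i v) (sub_pos.2 (hw n).1).le
    have h3 := abs_sub_le (f (x + w n • v)) (f (x + t • v)) (f x)
    have ht' : |f (x + t • v) - f x| ≤ t * (L * ‖v‖) := ht
    change |f (x + w n • v) - f x| ≤ w n * (L * ‖v‖)
    linarith
  simpa [A] using hsub (Set.right_mem_Icc.2 zero_le_one)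

/-- Along every ray from the origin a piecewise affine function differs from a linear function
by a uniformly bounded amount. -/
theorem exists_slope_bound {ι : Type*} [Finite ι] {κ : ι → Type*} {f : E → ℝ}
    {g : ∀ i, κ i → E →ᵃ[ℝ] ℝ} {F : ι → E →ᵃ[ℝ] ℝ}
    (hcov : ∀ x, ∃ i, x ∈ affineSublevel (g i))
    (hF : ∀ i, ∀ x ∈ affineSublevel (g i), f x = F i x) :
    ∃ C : ℝ, ∀ z, ∃ m : ℝ, ∀ t : ℝ, 0 ≤ t → |f (t • z) - t * m| ≤ C := by
  obtain ⟨-, L, -, hL⟩ :=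
    exists_abs_sub_le_of_closed_cover (fun i => isClosed_affineSublevel (g i)) hcov hF
  have hex : ∀ i, ∃ q, (affineSublevel (g i)).Nonempty → q ∈ affineSublevel (g i) := fun i => by
    by_cases h : (affineSublevel (g i)).Nonempty
    · exact ⟨h.some, fun _ => h.some_mem⟩
    · exact ⟨0, fun h' => absurd h' h⟩
  choose q hq using hex
  -- `L * ‖q i‖` pays for translating the ray to start at `q i`, and `|F i (q i)|` for the value
  -- there.
  obtain ⟨C, hC⟩ := (Set.finite_range fun i => L * ‖q i‖ + |F i (q i)|).bddAbove
  refine ⟨C, fun z => ?_⟩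
  obtain ⟨i, hi⟩ := exists_frequently_mem hcov fun n : ℕ => (n : ℝ) • z
  have hqi : q i ∈ affineSublevel (g i) := hq i (hi.exists.elim fun _ h => ⟨_, h⟩)
  have hz : ∀ k, (g i k).linear z ≤ 0 :=
    linear_nonpos_of_tendsto (g i) tendsto_natCast_atTop_atTop hi (by
      refine tendsto_const_nhds.congr' ?_
      filter_upwards [eventually_gt_atTop 0] with n hn
      rw [smul_smul, inv_mul_cancel₀ (by positivity), one_smul])
  refine ⟨(F i).linear z, fun t ht => le_trans ?_ (hC ⟨i, rfl⟩)⟩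
  have hmem : q i + t • z ∈ affineSublevel (g i) := fun k => by
    rw [affineMap_add, map_smul, smul_eq_mul]
    exact add_nonpos (mul_nonpos_of_nonneg_of_nonpos ht (hz k)) (hqi k)
  have h1 := hL (t • z) (q i)
  rw [add_comm, hF i _ hmem, affineMap_add, map_smul, smul_eq_mul] at h1
  have h2 := abs_sub_abs_le_abs_sub (f (t • z) - t * (F i).linear z) (F i (q i))
  rw [abs_sub_comm, ← sub_sub] at h1
  linarith

/-! ### Error bounds and coercivity -/

/-- On a polyhedral set, a positive multiple of the distance to the level set is dominated by the
positive part of the function, provided the function grows linearly on the part considered. -/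
theorem exists_error_bound_of_piece {κ : Type*} [Finite κ] {f : E → ℝ} {V : Set E}
    (g : κ → E →ᵃ[ℝ] ℝ) (F : E →ᵃ[ℝ] ℝ) (hF : ∀ x ∈ affineSublevel g, f x = F x)
    (hS : (levelSet f).Nonempty) {c C : ℝ} (hc : 0 < c) (hgrow : ∀ x ∈ V, c * ‖x‖ - C ≤ f x) :
    ∃ K : ℝ, ∀ x ∈ V, x ∈ affineSublevel g →
      Metric.infDist x (levelSet f) ≤ K * max (f x) 0 := by
  by_cases hP : ∃ p ∈ affineSublevel g, F p ≤ 0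
  · let g' : Option κ → E →ᵃ[ℝ] ℝ := fun k => k.elim F g
    have hg' : ∀ x, x ∈ affineSublevel g' ↔ F x ≤ 0 ∧ x ∈ affineSublevel g := fun x => by
      simp [affineSublevel, g', Option.forall]
    obtain ⟨p, hpg, hpF⟩ := hP
    have hne : (affineSublevel g').Nonempty := ⟨p, (hg' p).2 ⟨hpF, hpg⟩⟩
    have hsub : affineSublevel g' ⊆ levelSet f := fun x hx => by
      obtain ⟨h1, h2⟩ := (hg' x).1 hx
      exact (hF x h2).trans_le h1
    obtain ⟨τ, hτ, hh⟩ := hoffman_bound g' hne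
    refine ⟨τ⁻¹, fun x _ hxg => ?_⟩
    by_cases hx : f x ≤ 0
    · rw [Metric.infDist_zero_of_mem (show x ∈ levelSet f from hx)]
      positivity
    push Not at hx
    have hxP : x ∉ affineSublevel g' := fun h => hx.not_ge (hsub h)
    have hle := Metric.infDist_le_infDist_of_subset (x := x) hsub hne
    have hτx : τ * Metric.infDist x (affineSublevel g') ≤ f x := by
      obtain ⟨k, hk⟩ := hh x hxP
      -- A point of the piece satisfies every constraint from `g`, so a violation by one of them
      -- bounds the distance by a nonpositive number.
      cases k with
      | none => rw [hF x hxg]; exact hk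
      | some k => exact (hk.trans (hxg k)).trans hx.le
    rw [max_eq_left hx.le, ← div_eq_inv_mul, le_div_iff₀ hτ, mul_comm]
    exact (mul_le_mul_of_nonneg_left hle hτ.le).trans hτx
  · push Not at hP
    obtain ⟨s, hs⟩ := hS
    -- Outside this radius the growth bound gives `f x ≥ 1` on `V`; inside it, compactness gives a
    -- positive minimum.
    have hcomp : IsCompact (affineSublevel g ∩ Metric.closedBall 0 ((1 + C) / c)) :=
      (isCompact_closedBall _ _).inter_left (isClosed_affineSublevel g)
    obtain ⟨δ, hδ, hδF⟩ : ∃ δ : ℝ, 0 < δ ∧ ∀ x ∈ V, x ∈ affineSublevel g → δ ≤ f x := by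
      obtain ⟨η, hη, hηF⟩ : ∃ η : ℝ, 0 < η ∧
          ∀ x ∈ affineSublevel g ∩ Metric.closedBall 0 ((1 + C) / c), η ≤ F x := by
        rcases (affineSublevel g ∩ Metric.closedBall 0 ((1 + C) / c)).eq_empty_or_nonempty with h | h
        · exact ⟨1, one_pos, by simp [h]⟩
        · obtain ⟨y, hy, hmin⟩ := hcomp.exists_isMinOn h
            (AffineMap.continuous_of_finiteDimensional F).continuousOn
          exact ⟨F y, hP y hy.1, fun x hx => hmin hx⟩
      refine ⟨min η 1, lt_min hη one_pos, fun x hxV hxg => ?_⟩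
      by_cases hx : ‖x‖ ≤ (1 + C) / c
      · exact (min_le_left _ _).trans
          ((hηF x ⟨hxg, by simpa using hx⟩).trans_eq (hF x hxg).symm)
      · push Not at hx
        rw [div_lt_iff₀ hc] at hx
        exact (min_le_right _ _).trans (by linarith [hgrow x hxV])
    -- The term over `δ` absorbs the constants `|C| / c + ‖s‖`, using `δ ≤ f x`.
    refine ⟨1 / c + (|C| / c + ‖s‖) / δ, fun x hxV hxg => ?_⟩
    have hfx := hδF x hxV hxg
    have hnorm : ‖x‖ ≤ (f x + |C|) / c := by
      rw [le_div_iff₀ hc]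
      linarith [hgrow x hxV, le_abs_self C]
    have h1 : Metric.infDist x (levelSet f) ≤ ‖x‖ + ‖s‖ :=
      (Metric.infDist_le_dist_of_mem hs).trans (dist_le_norm_add_norm x s)
    have h2 : |C| / c + ‖s‖ ≤ (|C| / c + ‖s‖) / δ * f x := by
      rw [div_mul_eq_mul_div, le_div_iff₀ hδ]
      exact mul_le_mul_of_nonneg_left hfx (by positivity)
    rw [max_eq_left (hδ.le.trans hfx)]
    calc Metric.infDist x (levelSet f) ≤ (f x + |C|) / c + ‖s‖ := by linarith
      _ = 1 / c * f x + (|C| / c + ‖s‖) := by ring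
      _ ≤ 1 / c * f x + (|C| / c + ‖s‖) / δ * f x := by linarith
      _ = _ := by ring

theorem hasErrorBoundOn_of_linear_growth {ι : Type*} [Finite ι] {κ : ι → Type*}
    [∀ i, Finite (κ i)] {f : E → ℝ} {g : ∀ i, κ i → E →ᵃ[ℝ] ℝ} {F : ι → E →ᵃ[ℝ] ℝ}
    (hcov : ∀ x, ∃ i, x ∈ affineSublevel (g i))
    (hF : ∀ i, ∀ x ∈ affineSublevel (g i), f x = F i x) (hS : (levelSet f).Nonempty) {V : Set E}
    {c C : ℝ} (hc : 0 < c) (hgrow : ∀ x ∈ V, c * ‖x‖ - C ≤ f x) : HasErrorBoundOn f V := by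
  choose K hK using fun i => exists_error_bound_of_piece (g i) (F i) (hF i) hS hc hgrow
  obtain ⟨M, hM⟩ := (Set.finite_range K).bddAbove
  have hpos : 0 < max M 1 := lt_max_of_lt_right one_pos
  refine ⟨(max M 1)⁻¹, inv_pos.2 hpos, fun x hx => ?_⟩
  obtain ⟨i, hi⟩ := hcov x
  rw [← div_eq_inv_mul, div_le_iff₀ hpos, mul_comm]
  exact (hK i x hx hi).trans (mul_le_mul_of_nonneg_right
    ((hM ⟨i, rfl⟩).trans (le_max_left _ _)) (le_max_right _ _))

/-- Bounded values keep a sequence at bounded distance from S(f), so after normalisation it shares a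
limit `u` with nearby points of S(f). Infinitely many of these lie in one polyhedral piece of S(f),
making `u` a recession direction. -/
theorem isCoerciveOn_of_hasErrorBoundOn {ι : Type*} [Finite ι] {κ : ι → Type*}
    {f : E → ℝ} {g : ∀ i, κ i → E →ᵃ[ℝ] ℝ} {F : ι → E →ᵃ[ℝ] ℝ}
    (hcov : ∀ x, ∃ i, x ∈ affineSublevel (g i))
    (hF : ∀ i, ∀ x ∈ affineSublevel (g i), f x = F i x) (hS : (levelSet f).Nonempty) {V : Set E}
    (hV : IsCone V) (hrec : recessionCone (levelSet f) ∩ closure V ⊆ {0})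
    (heb : HasErrorBoundOn f V) : IsCoerciveOn f V := by
  obtain ⟨τ, hτ, hb⟩ := heb
  intro x hxV hxn
  by_contra hnot
  rw [tendsto_atTop] at hnot
  push Not at hnot
  obtain ⟨M, hfreq⟩ := hnot
  obtain ⟨φ, hφ, hφM⟩ := extraction_of_frequently_atTop hfreq
  set r : ℕ → ℝ := fun n => ‖x (φ n)‖ with hr
  have hrt : Tendsto r atTop atTop := hxn.comp hφ.tendsto_atTop
  have hd : ∀ n, ∃ s ∈ levelSet f, dist (x (φ n)) s < max M 0 / τ + 1 := fun n => by
    refine (Metric.infDist_lt_iff hS).1 ?_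
    have h1 := hb _ (hxV (φ n))
    have h2 : max (f (x (φ n))) 0 ≤ max M 0 := max_le_max_right _ (hφM n).le
    have h3 : Metric.infDist (x (φ n)) (levelSet f) ≤ max M 0 / τ := by
      rw [le_div_iff₀ hτ, mul_comm]
      exact h1.trans h2
    linarith
  choose s hs hsd using hd
  -- A ball, not the sphere: early terms may be zero.
  have hbdd : ∀ n, (r n)⁻¹ • x (φ n) ∈ Metric.closedBall (0 : E) 1 := fun n => by
    rw [mem_closedBall_zero_iff, norm_smul, norm_inv, norm_norm]
    exact inv_mul_le_one
  obtain ⟨u, -, ψ, hψ, hu⟩ := (isCompact_closedBall (0 : E) 1).tendsto_subseq hbdd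
  have hrψ : Tendsto (r ∘ ψ) atTop atTop := hrt.comp hψ.tendsto_atTop
  have hu1 : ‖u‖ = 1 := by
    refine tendsto_nhds_unique hu.norm (tendsto_const_nhds.congr' ?_)
    filter_upwards [hrψ.eventually_gt_atTop 0] with n hn
    simp only [Function.comp_apply] at hn ⊢
    rw [norm_smul, norm_inv, Real.norm_of_nonneg hn.le]
    exact (inv_mul_cancel₀ hn.ne').symm
  have huV : u ∈ closure V := by
    refine mem_closure_of_tendsto hu ?_
    filter_upwards [hrψ.eventually_gt_atTop 0] with n hn
    exact hV _ (hxV _) _ (inv_pos.2 hn)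
  have hdiff : Tendsto (fun n => (r (ψ n))⁻¹ • (s (ψ n) - x (φ (ψ n)))) atTop (𝓝 0) := by
    refine squeeze_zero_norm' (a := fun n => (r (ψ n))⁻¹ * (max M 0 / τ + 1)) ?_ ?_
    · filter_upwards [hrψ.eventually_gt_atTop 0] with n hn
      have hn' : 0 < (r (ψ n))⁻¹ := inv_pos.2 hn
      rw [norm_smul, Real.norm_of_nonneg hn'.le, ← dist_eq_norm, dist_comm]
      exact mul_le_mul_of_nonneg_left (hsd _).le hn'.le
    · simpa using (tendsto_inv_atTop_zero.comp hrψ).mul_const (max M 0 / τ + 1)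
  have hsu : Tendsto (fun n => ((r ∘ ψ) n)⁻¹ • s (ψ n)) atTop (𝓝 u) := by
    have := hu.add hdiff
    rw [add_zero] at this
    refine this.congr fun n => ?_
    simp only [Function.comp_apply]
    module
  obtain ⟨i, hi⟩ := exists_frequently_mem hcov fun n => s (ψ n)
  let g' : Option (κ i) → E →ᵃ[ℝ] ℝ := fun k => k.elim (F i) (g i)
  have hg' : ∀ x, x ∈ affineSublevel g' ↔ F i x ≤ 0 ∧ x ∈ affineSublevel (g i) := fun x => by
    simp [affineSublevel, g', Option.forall]
  have hmem : ∃ᶠ n in atTop, s (ψ n) ∈ affineSublevel g' :=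
    hi.mono fun n hn => (hg' _).2 ⟨(hF i _ hn).symm.trans_le (hs _), hn⟩
  have hlin := linear_nonpos_of_tendsto g' hrψ hmem hsu
  obtain ⟨n, hn⟩ := hmem.exists
  have hurec : u ∈ recessionCone (levelSet f) := by
    refine ⟨s (ψ n), hs _, fun t ht => ?_⟩
    have hray : s (ψ n) + t • u ∈ affineSublevel g' := fun k => by
      rw [affineMap_add, map_smul, smul_eq_mul]
      exact add_nonpos (mul_nonpos_of_nonneg_of_nonpos ht (hlin k)) (hn k)
    obtain ⟨h1, h2⟩ := (hg' _).1 hray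
    exact (hF i _ h2).trans_le h1
  have h0 : u = 0 := hrec ⟨hurec, huV⟩
  rw [h0, norm_zero] at hu1
  exact zero_ne_one hu1

end

/-! ### The lower limit at infinity -/

section

variable {E : Type*} [NormedAddCommGroup E]

theorem growthAtInfinity_pos_of_linear_growth {f : E → ℝ} {c C : ℝ} (hc : 0 < c)
    (hgrow : ∀ x, c * ‖x‖ - C ≤ f x) : 0 < growthAtInfinity f := by
  -- Half the slope absorbs `C` once `‖x‖ ≥ 2 * C / c`.
  have hpos : (0 : EReal) < ((c / 2 : ℝ) : EReal) := by exact_mod_cast half_pos hc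
  refine hpos.trans_le (le_liminf_of_le (by isBoundedDefault) ?_)
  have hev : ∀ᶠ x : E in comap (fun x : E => ‖x‖) atTop, max 1 (2 * C / c) ≤ ‖x‖ :=
    tendsto_comap.eventually (eventually_ge_atTop _)
  filter_upwards [hev] with x hx
  have hx1 : 0 < ‖x‖ := one_pos.trans_le ((le_max_left _ _).trans hx)
  have hx2 := (div_le_iff₀ hc).1 ((le_max_right _ _).trans hx)
  refine EReal.coe_le_coe_iff.2 ((le_div_iff₀ hx1).2 ?_)
  linarith [hgrow x]

theorem isCoerciveFun_of_growthAtInfinity_pos {f : E → ℝ}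
    (h : 0 < growthAtInfinity f) : IsCoerciveFun f := by
  obtain ⟨c, hc0, hc⟩ := EReal.lt_iff_exists_real_btwn.1 h
  have hc0' : 0 < c := by exact_mod_cast hc0
  have hev := eventually_lt_of_lt_liminf hc
  intro x _ hx
  have hxc : Tendsto x atTop (comap (fun x : E => ‖x‖) atTop) := tendsto_comap_iff.2 hx
  refine tendsto_atTop_mono' _ ?_ (hx.const_mul_atTop hc0')
  filter_upwards [hxc.eventually hev, hx.eventually_gt_atTop 0] with n hn hpos
  exact ((lt_div_iff₀ hpos).1 (EReal.coe_lt_coe_iff.1 hn)).le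

end

end PAErrorBound

open PAErrorBound
theorem mainTheorem7 {E : Type*} [NormedAddCommGroup E] [NormedSpace ℝ E]
    [FiniteDimensional ℝ E] (f : E → ℝ) (hf : IsPiecewiseAffine f) :
    ((levelSet f).Nonempty → ∀ V : Set E, IsCone V →
      (IsCoerciveOn f V → HasErrorBoundOn f V) ∧
      (recessionCone (levelSet f) ∩ closure V = {0} →
        HasErrorBoundOn f V → IsCoerciveOn f V)) ∧
    ((levelSet f).Nonempty → IsCoerciveFun f → HasGlobalErrorBound f) ∧
    (IsCoerciveFun f ↔ 0 < growthAtInfinity f) := by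
  obtain ⟨s, Q, F, hQ, hF⟩ := hf
  choose m g hg using fun i => (hQ.polyhedral i).exists_affineSublevel
  have hcov : ∀ x, ∃ i, x ∈ affineSublevel (g i) := fun x => by
    obtain ⟨i, hi⟩ := Set.mem_iUnion.1 (hQ.cover ▸ Set.mem_univ x)
    exact ⟨i, hg i ▸ hi⟩
  have hFg : ∀ i, ∀ x ∈ affineSublevel (g i), f x = F i x := fun i x hx =>
    hF i x ((hg i).symm ▸ hx)
  obtain ⟨C, hC⟩ := exists_slope_bound hcov hFg
  have hcone : IsCone (Set.univ : Set E) := fun _ _ _ _ => Set.mem_univ _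
  have hforward : (levelSet f).Nonempty → ∀ V : Set E, IsCone V →
      IsCoerciveOn f V → HasErrorBoundOn f V := fun hS V hV hco => by
    obtain ⟨c, hc, hgrow⟩ := hco.exists_linear_growth hC hV
    exact hasErrorBoundOn_of_linear_growth hcov hFg hS hc hgrow
  refine ⟨fun hS V hV => ⟨hforward hS V hV, fun hrec =>
    isCoerciveOn_of_hasErrorBoundOn hcov hFg hS hV hrec.subset⟩,
    fun hS => hforward hS _ hcone, fun hco => ?_, isCoerciveFun_of_growthAtInfinity_pos⟩
  obtain ⟨c, hc, hgrow⟩ := IsCoerciveOn.exists_linear_growth hC hcone hco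
  exact growthAtInfinity_pos_of_linear_growth hc fun x => hgrow x (Set.mem_univ x)
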